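/- Let $p$ be an odd prime, $r\ge 1$ an integer, $\zeta$ a primitive $p^r$-th root of unity, and $K=\mathbb{Q}(\zeta+\zeta^{-1})$, a totally real number field with ring of integers $\mathcal{O}_K$. An ideal lattice over $K$ is a pair $(I,\alpha)$, where $I$ is a nonzero fractional $\mathcal{O}_K$-ideal and $\alpha\in K^\times$ is totally positive, equipped with the form $b_\alpha(x,y)=\mathrm{Tr}_{K/\mathbb{Q}}(\alpha xy)$; its dual lattice is $I^*=\{x\in K : b_\alpha(x,y)\in\mathbb{Z}\text{ for all }y\in I\}$. It is Arakelov-modular of level $\ell$ if there is $\beta\in K^\times$ with $I=\beta I^*$ and $\ell=\beta^2$, and it is of trace type if $\alpha=1$. Let $\mathrm{Mod}_T(p^r)$ be the set of square-free positive integers $\ell$ such that there exists an Arakelov-modular lattice of trace type of level $\ell$ over $K$. Then 1. $\mathrm{Mod}_T(p^r)=\{1\}$ if $p\equiv 3\pmod 4$; 2. $\mathrm{Mod}_T(p^r)=\emptyset$ if $p\equiv 1\pmod 8$; 3. $\mathrm{Mod}_T(p^r)=\{p\}$ if $p\equiv 5\pmod 8$. -/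

import Mathlib

open NumberField
open scoped nonZeroDivisors

noncomputable section

/-- An ideal lattice `(I, b_α)` over a totally real number field `K`: a nonzero fractional
`𝓞 K`-ideal `I` together with a totally positive `α ∈ K` (which is then nonzero). All embeddings
of a totally real field are real, so total positivity is tested on the embeddings `K →+* ℝ`. -/
structure IdealLattice (K : Type*) [Field K] [NumberField K] [IsTotallyReal K] where
  ideal : FractionalIdeal (𝓞 K)⁰ K
  ideal_ne_zero : ideal ≠ 0
  alpha : K
  alpha_totallyPositive : ∀ σ : K →+* ℝ, 0 < σ alpha

namespace IdealLattice

variable {K : Type*} [Field K] [NumberField K] [IsTotallyReal K]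

/-- The form `b_α(x, y) = Tr_{K/ℚ}(α x y)`, as a `ℚ`-bilinear form on `K`
(complex conjugation is the identity on a totally real field). -/
def form (Λ : IdealLattice K) : LinearMap.BilinForm ℚ K :=
  (Algebra.traceForm ℚ K).comp (LinearMap.mulLeft ℚ Λ.alpha) LinearMap.id

theorem form_apply (Λ : IdealLattice K) (x y : K) :
    Λ.form x y = Algebra.trace ℚ K (Λ.alpha * x * y) := rfl

/-- The ideal `I` as a `ℤ`-lattice in `K`. -/
def lattice (Λ : IdealLattice K) : Submodule ℤ K :=
  (Λ.ideal : Submodule (𝓞 K) K).restrictScalars ℤ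

/-- The dual lattice `I^* = {x ∈ K : b_α(x, y) ∈ ℤ for all y ∈ I}`. -/
def dual (Λ : IdealLattice K) : Submodule ℤ K :=
  Λ.form.dualSubmodule Λ.lattice

/-- `(I, b_α)` is Arakelov-modular of level `ℓ`: there is `β ∈ K^×` with `I = β I^*` and
`ℓ = β β̄ = β * β`. -/
def IsArakelovModular (Λ : IdealLattice K) (ℓ : ℕ) : Prop :=
  ∃ β : K, β ≠ 0 ∧ Λ.lattice = Λ.dual.map (LinearMap.mulLeft ℤ β) ∧ (ℓ : K) = β * β

/-- Trace type: `α = 1`. -/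
def IsTraceType (Λ : IdealLattice K) : Prop := Λ.alpha = 1

end IdealLattice

/-- The set of square-free (in particular positive) levels `ℓ` of Arakelov-modular lattices of
trace type over `K`. -/
def traceTypeLevels (K : Type*) [Field K] [NumberField K] [IsTotallyReal K] : Set ℕ :=
  {ℓ | Squarefree ℓ ∧ ∃ Λ : IdealLattice K, Λ.IsTraceType ∧ Λ.IsArakelovModular ℓ}

/-- The field `ℚ(ζ + ζ⁻¹)` inside a number field `L`. -/
abbrev realCyclotomicSubfield (L : Type*) [Field L] [NumberField L] (ζ : L) :
    IntermediateField ℚ L :=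
  IntermediateField.adjoin ℚ {ζ + ζ⁻¹}

theorem isTotallyReal_realCyclotomicSubfield {L : Type*} [Field L] [NumberField L] {ζ : L} {n : ℕ}
    (hn : n ≠ 0) (hζ : IsPrimitiveRoot ζ n) :
    IsTotallyReal (realCyclotomicSubfield L ζ) := by
  have hle : (realCyclotomicSubfield L ζ).toSubfield ≤ maximalRealSubfield L := by
    rw [IntermediateField.adjoin_toSubfield, Subfield.closure_le, Set.union_subset_iff]
    constructor
    · rintro _ ⟨q, rfl⟩ φ
      simp
    · rintro _ rfl φ
      have h1 : ‖φ ζ‖ = 1 :=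
        Complex.norm_eq_one_of_pow_eq_one (by rw [← map_pow, hζ.pow_eq_one, map_one]) hn
      have h2 : star (φ ζ) = (φ ζ)⁻¹ := (Complex.inv_eq_conj h1).symm
      rw [map_add, map_inv₀, star_add, star_inv₀, h2, inv_inv, add_comm]
  exact isTotallyReal_iff_le_maximalRealSubfield.mpr hle

end

/-! ### Trace-type lattices and the different -/

namespace IdealLattice

variable {K : Type*} [Field K] [NumberField K] [IsTotallyReal K]

/-! For `α = 1` the dual of `I` is `I⁻¹𝔇⁻¹`, so the problem is to solve `I²𝔇 = (β)` with `β² = ℓ`.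
Primes dividing `ℓ` ramify and the discriminant is `± p ^ d`, so `ℓ` is `1` or `p`. With `n = [K :
ℚ]`, norms give `N(I)⁴ p ^ (2d) = ℓ ^ n`: `d` is even if `ℓ = 1`, and `4 ∣ n - 2d` if `ℓ = p`
(`eq_of_mem_traceTypeLevels`). Conversely `p` is totally ramified, so `𝔇 = P ^ d` and these
conditions suffice, provided `√p ∈ K` when `ℓ = p`.

For the real cyclotomic field, the discriminant tower formula gives `2d + 1 = p ^ k ((p - 1)(k + 1)
- 1)` with `r = k + 1` (`exists_natAbs_discr_eq`), so `d` is odd iff `p ≡ 1 mod 4`. Since `2n = p ^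
k (p - 1)`, the three cases follow; a Gauss sum supplies `√p`. -/

theorem dual_eq_of_isTraceType {Λ : IdealLattice K} (h : Λ.IsTraceType) :
    Λ.dual = ((FractionalIdeal.dual ℤ ℚ Λ.ideal : FractionalIdeal (𝓞 K)⁰ K) :
      Submodule (𝓞 K) K).restrictScalars ℤ := by
  have hform : Λ.form = Algebra.traceForm ℚ K := by
    ext x y
    rw [form_apply, h, one_mul, Algebra.traceForm_apply]
  rw [dual, hform, FractionalIdeal.coe_dual ℤ ℚ Λ.ideal_ne_zero]
  rfl

/-- A lattice of trace type is Arakelov-modular of level `ℓ` iff `I² 𝔇 = (β)` for some square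
root `β` of `ℓ`, where `𝔇` is the different of `K`. -/
theorem isArakelovModular_iff {Λ : IdealLattice K} (h : Λ.IsTraceType) (ℓ : ℕ) :
    Λ.IsArakelovModular ℓ ↔ ∃ β : K, β ≠ 0 ∧ (ℓ : K) = β * β ∧
      Λ.ideal * Λ.ideal * (differentIdeal ℤ (𝓞 K) : FractionalIdeal (𝓞 K)⁰ K) =
        FractionalIdeal.spanSingleton (𝓞 K)⁰ β := by
  have key (β : K) : Λ.lattice = Λ.dual.map (LinearMap.mulLeft ℤ β) ↔
      Λ.ideal = FractionalIdeal.spanSingleton (𝓞 K)⁰ β * FractionalIdeal.dual ℤ ℚ Λ.ideal := by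
    rw [dual_eq_of_isTraceType h]
    simp only [SetLike.ext_iff, lattice, Submodule.mem_map, Submodule.restrictScalars_mem,
      FractionalIdeal.mem_coe, LinearMap.mulLeft_apply, FractionalIdeal.mem_singleton_mul]
    refine forall_congr' fun x ↦ ?_
    simp only [eq_comm (a := x)]
  have hd : (FractionalIdeal.dual ℤ ℚ (1 : FractionalIdeal (𝓞 K)⁰ K)) ≠ 0 :=
    FractionalIdeal.dual_ne_zero ℤ ℚ one_ne_zero
  have hI := Λ.ideal_ne_zero
  refine exists_congr fun β ↦ ⟨fun ⟨h0, h1, h2⟩ ↦ ⟨h0, h2, ?_⟩, fun ⟨h0, h2, h1⟩ ↦ ⟨h0, ?_, h2⟩⟩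
  · rw [key, FractionalIdeal.dual_eq_mul_inv] at h1
    rw [coeIdeal_differentIdeal ℤ ℚ]
    nth_rewrite 1 [h1]
    field_simp
  · rw [key, FractionalIdeal.dual_eq_mul_inv, ← h1, coeIdeal_differentIdeal ℤ ℚ]
    field_simp

end IdealLattice

open FractionalIdeal in
theorem mem_traceTypeLevels_iff {K : Type*} [Field K] [NumberField K] [IsTotallyReal K] {ℓ : ℕ} :
    ℓ ∈ traceTypeLevels K ↔ Squarefree ℓ ∧ ∃ (I : FractionalIdeal (𝓞 K)⁰ K) (β : K),
      (ℓ : K) = β * β ∧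
      I * I * (differentIdeal ℤ (𝓞 K) : FractionalIdeal (𝓞 K)⁰ K) = spanSingleton (𝓞 K)⁰ β := by
  refine and_congr_right fun hℓ ↦ ⟨?_, ?_⟩
  · rintro ⟨Λ, h, hm⟩
    obtain ⟨β, -, h1, h2⟩ := (IdealLattice.isArakelovModular_iff h ℓ).mp hm
    exact ⟨Λ.ideal, β, h1, h2⟩
  · rintro ⟨I, β, h1, h2⟩
    have hβ : β ≠ 0 := by
      rintro rfl
      exact hℓ.ne_zero (by simpa using h1)
    have hI : I ≠ 0 := by
      rintro rfl
      rw [zero_mul, zero_mul, eq_comm, spanSingleton_eq_zero_iff] at h2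
      exact hβ h2
    let Λ : IdealLattice K := ⟨I, hI, 1, by simp⟩
    exact ⟨Λ, rfl, (IdealLattice.isArakelovModular_iff (Λ := Λ) rfl ℓ).mpr ⟨β, hβ, h1, h2⟩⟩

/-! ### Levels when the discriminant is a power of `p` -/

section Levels

variable {K : Type*} [Field K] [NumberField K] {p : ℕ} [hp : Fact p.Prime] {d : ℕ}

theorem exists_integer_of_natCast_eq_mul_self {K : Type*} [Field K] {m : ℕ} {β : K}
    (hβ : (m : K) = β * β) :
    ∃ b : 𝓞 K, (b : K) = β ∧ (m : 𝓞 K) = b * b := by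
  have hint : IsIntegral ℤ β := by
    refine IsIntegral.of_pow two_pos ?_
    rw [sq, ← hβ, ← map_natCast (algebraMap ℤ K)]
    exact isIntegral_algebraMap
  obtain ⟨b, rfl⟩ : ∃ b : 𝓞 K, (b : K) = β := ⟨⟨β, hint⟩, rfl⟩
  exact ⟨b, rfl, RingOfIntegers.ext (by simpa using hβ)⟩

/-- Primes dividing a square-free `ℓ` ramify in a field containing `√ℓ`. -/
theorem dvd_discr_of_mul_self_eq {ℓ q : ℕ} (hℓ : Squarefree ℓ) (hq : q.Prime) (hqℓ : q ∣ ℓ) {β : K}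
    (hβ : (ℓ : K) = β * β) : (q : ℤ) ∣ discr K := by
  obtain ⟨b, rfl, hb⟩ := exists_integer_of_natCast_eq_mul_self hβ
  obtain ⟨m, rfl⟩ := hqℓ
  have hcop : Nat.Coprime q m := Nat.coprime_of_squarefree_mul hℓ
  have hqZ : Prime (q : ℤ) := Nat.prime_iff_prime_int.mp hq
  have hne : Ideal.span {(q : ℤ)} ≠ ⊥ := by simpa using hq.ne_zero
  have : (Ideal.span {(q : ℤ)}).IsMaximal :=
    ((Ideal.span_singleton_prime hqZ.ne_zero).mpr hqZ).isMaximal hne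
  obtain ⟨Q, hQ, hQl⟩ := Ideal.exists_maximal_ideal_liesOver_of_isIntegral (S := 𝓞 K)
    (Ideal.span {(q : ℤ)})
  have hqQ : (q : 𝓞 K) ∈ Q := by
    have : (q : ℤ) ∈ Ideal.under ℤ Q := hQl.over ▸ Ideal.mem_span_singleton_self _
    simpa [Ideal.mem_comap] using this
  have hbQ : b ∈ Q := by
    refine (hQ.isPrime.mem_or_mem (x := b) (y := b) ?_).elim id id
    rw [← hb, Nat.cast_mul]
    exact Q.mul_mem_right _ hqQ
  -- With `u q + v m = 1` and `q m = b²`, one has `q = u q² + v b²`, so `Q` is ramified and divides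
  -- the different.
  have hq2 : (q : 𝓞 K) ∈ Q ^ 2 := by
    obtain ⟨u, v, huv⟩ := Nat.isCoprime_iff_coprime.mpr hcop
    have huv' : (u : 𝓞 K) * q + v * m = 1 := by exact_mod_cast congrArg (Int.cast : ℤ → 𝓞 K) huv
    have : (q : 𝓞 K) = u * (q * q) + v * (b * b) := by
      rw [← hb, Nat.cast_mul]
      linear_combination -(q : 𝓞 K) * huv'
    rw [this, sq]
    exact add_mem (Ideal.mul_mem_left _ _ (Ideal.mul_mem_mul hqQ hqQ))
      (Ideal.mul_mem_left _ _ (Ideal.mul_mem_mul hbQ hbQ))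
  have hdvd : Q ∣ differentIdeal ℤ (𝓞 K) := by
    have := pow_sub_one_dvd_differentIdeal ℤ Q 2 hne (by
      rw [Ideal.map_span, Set.image_singleton, Ideal.dvd_span_singleton]
      simpa using hq2)
    simpa using this
  have h1 := map_dvd Ideal.absNorm hdvd
  rw [absNorm_differentIdeal K, ← Int.natCast_dvd_natCast, Int.dvd_natAbs] at h1
  refine dvd_trans ?_ h1
  rw [← Ideal.natAbs_pow_inertiaDeg (q : ℤ) (P := Q), ← Int.natAbs_pow, Int.dvd_natAbs]
  exact dvd_pow_self _ (Ideal.inertiaDeg_pos ..).ne'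

open FractionalIdeal in
/-- The norm condition on the level of a trace type Arakelov-modular lattice when the
discriminant is a power of `p`. -/
theorem eq_of_mem_traceTypeLevels [IsTotallyReal K] (hd : (discr K).natAbs = p ^ d) {ℓ : ℕ}
    (hℓ : ℓ ∈ traceTypeLevels K) :
    (ℓ = 1 ∧ Even d) ∨ (ℓ = p ∧ (4 : ℤ) ∣ Module.finrank ℚ K - 2 * d) := by
  obtain ⟨hsq, I, β, hβ, hI⟩ := mem_traceTypeLevels_iff.mp hℓ
  have hp0 : (p : ℚ) ≠ 0 := by exact_mod_cast hp.out.ne_zero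
  have hprime : ∀ q : ℕ, q.Prime → q ∣ ℓ → q = p := fun q hq hqℓ ↦ by
    have := dvd_discr_of_mul_self_eq hsq hq hqℓ hβ
    rw [← Int.dvd_natAbs, Int.natCast_dvd_natCast, hd] at this
    exact (Nat.prime_dvd_prime_iff_eq hq hp.out).mp (hq.dvd_of_dvd_pow this)
  have hnorm : (ℓ : ℚ) ^ Module.finrank ℚ K = Algebra.norm ℚ β ^ 2 := by
    have := congrArg (Algebra.norm ℚ) hβ
    rwa [map_mul, ← map_natCast (algebraMap ℚ K), Algebra.norm_algebraMap, ← sq] at this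
  have hN := congrArg absNorm hI
  rw [map_mul, map_mul, coeIdeal_absNorm, absNorm_differentIdeal K, absNorm_span_singleton, hd,
    Nat.cast_pow, ← sq] at hN
  have hmain : absNorm I ^ 4 * (p : ℚ) ^ (2 * d) = (ℓ : ℚ) ^ Module.finrank ℚ K := by
    rw [hnorm, ← sq_abs, ← hN]
    ring
  have hI0 : absNorm I ≠ 0 := by
    intro h0
    rw [h0, zero_pow four_ne_zero, zero_mul] at hmain
    exact hsq.ne_zero (by exact_mod_cast (pow_eq_zero_iff'.mp hmain.symm).1)
  have hval := congrArg (padicValRat p) hmain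
  rw [padicValRat.mul (pow_ne_zero _ hI0) (pow_ne_zero _ hp0), padicValRat.pow,
    padicValRat.pow, padicValRat.self hp.out.one_lt] at hval
  by_cases h1 : ℓ = 1
  · refine .inl ⟨h1, ?_⟩
    subst h1
    simp only [Nat.cast_one, one_pow, padicValRat.one] at hval
    push_cast at hval
    have : (d : ℤ) = 2 * -padicValRat p (absNorm I) := by linarith
    exact (Int.even_coe_nat d).mp (this ▸ even_two_mul _)
  · right
    obtain ⟨q, hq, hqℓ⟩ := Nat.exists_prime_and_dvd h1
    obtain rfl := hprime q hq hqℓ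
    obtain ⟨m, rfl⟩ := hqℓ
    have hm : m = 1 := by
      by_contra hm
      obtain ⟨s, hs, m', rfl⟩ := Nat.exists_prime_and_dvd hm
      obtain rfl := hprime s hs ⟨q * m', by ring⟩
      exact hs.one_lt.ne' (Nat.isUnit_iff.mp (hsq s ⟨m', by ring⟩))
    subst hm
    refine ⟨mul_one _, ?_⟩
    rw [padicValRat.pow, Nat.mul_one, padicValRat.self hp.out.one_lt] at hval
    push_cast at hval
    exact ⟨padicValRat q (absNorm I), by linarith⟩

/-- If `p` has only one prime `P` above it and `P` has norm `p`, then the ideals of `p`-power norm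
are the powers of `P`. -/
theorem eq_pow_of_absNorm_eq_pow {P : Ideal (𝓞 K)} (hP : Ideal.absNorm P = p)
    (huniq : ∀ Q : Ideal (𝓞 K), Q.IsPrime → Q.LiesOver (Ideal.span {(p : ℤ)}) → Q = P) :
    ∀ {k : ℕ} {J : Ideal (𝓞 K)}, Ideal.absNorm J = p ^ k → J = P ^ k
  | 0, J, h => by simpa using h
  | k + 1, J, h => by
    obtain ⟨Q, hQ, h1, h2⟩ := Ideal.exists_isMaximal_dvd_of_dvd_absNorm
      (Nat.prime_iff_prime_int.mp hp.out) J (by rw [h, pow_succ]; push_cast; exact dvd_mul_left _ _)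
    obtain rfl := huniq Q hQ.isPrime ⟨h1.symm⟩
    obtain ⟨J', rfl⟩ := h2
    rw [map_mul, hP, pow_succ', Nat.mul_right_inj hp.out.ne_zero] at h
    rw [eq_pow_of_absNorm_eq_pow hP huniq h, pow_succ']

-- Here `𝔇 = P ^ (2m)`, so `I = P ^ (-m)` and `β = 1` work.
open FractionalIdeal in
theorem one_mem_traceTypeLevels [IsTotallyReal K] (hd : (discr K).natAbs = p ^ d) {P : Ideal (𝓞 K)}
    (hP : Ideal.absNorm P = p)
    (huniq : ∀ Q : Ideal (𝓞 K), Q.IsPrime → Q.LiesOver (Ideal.span {(p : ℤ)}) → Q = P)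
    (heven : Even d) : 1 ∈ traceTypeLevels K := by
  obtain ⟨m, rfl⟩ := heven
  have hD := eq_pow_of_absNorm_eq_pow hP huniq ((absNorm_differentIdeal K (𝓞 K)).trans hd)
  have hP0 : (P : FractionalIdeal (𝓞 K)⁰ K) ≠ 0 := by
    rw [Ne, coeIdeal_eq_zero]
    rintro rfl
    exact hp.out.ne_zero (by simpa using hP.symm)
  refine mem_traceTypeLevels_iff.mpr
    ⟨squarefree_one, (P : FractionalIdeal (𝓞 K)⁰ K)⁻¹ ^ m, 1, by simp, ?_⟩
  rw [hD, coeIdeal_pow, spanSingleton_one, pow_add, ← mul_pow, ← mul_pow, ← mul_pow]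
  field_simp
  simp

-- With `n = 2e`, both `𝔇 = P ^ d` and `(√p) = P ^ e` hold, so `I = P ^ m` works when `2m + d = e`,
-- that is `4m = n - 2d`; `m` may be negative.
open FractionalIdeal in
theorem prime_mem_traceTypeLevels [IsTotallyReal K] (hd : (discr K).natAbs = p ^ d)
    {P : Ideal (𝓞 K)} (hP : Ideal.absNorm P = p)
    (huniq : ∀ Q : Ideal (𝓞 K), Q.IsPrime → Q.LiesOver (Ideal.span {(p : ℤ)}) → Q = P)
    {β : K} (hβ : (p : K) = β * β) (h4 : (4 : ℤ) ∣ Module.finrank ℚ K - 2 * d) :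
    p ∈ traceTypeLevels K := by
  obtain ⟨m, hm⟩ := h4
  obtain ⟨e, he⟩ : ∃ e : ℕ, Module.finrank ℚ K = e + e := ⟨Module.finrank ℚ K / 2, by omega⟩
  have hD := eq_pow_of_absNorm_eq_pow hP huniq ((absNorm_differentIdeal K (𝓞 K)).trans hd)
  have hP0 : (P : FractionalIdeal (𝓞 K)⁰ K) ≠ 0 := by
    rw [Ne, coeIdeal_eq_zero]
    rintro rfl
    exact hp.out.ne_zero (by simpa using hP.symm)
  obtain ⟨b, rfl, hb⟩ := exists_integer_of_natCast_eq_mul_self hβ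
  have hbN : Ideal.absNorm (Ideal.span {b}) = p ^ e := by
    have h1 : Ideal.absNorm (Ideal.span {(p : 𝓞 K)}) = p ^ Module.finrank ℚ K := by
      rw [← RingOfIntegers.rank K]
      exact Ideal.absNorm_span_natCast p
    rw [hb, ← Ideal.span_singleton_mul_span_singleton, map_mul, he, ← two_mul, pow_mul', ← sq]
      at h1
    exact Nat.pow_left_injective two_ne_zero h1
  have hbP := eq_pow_of_absNorm_eq_pow hP huniq hbN
  refine mem_traceTypeLevels_iff.mpr
    ⟨hp.out.prime.squarefree, (P : FractionalIdeal (𝓞 K)⁰ K) ^ m, b, hβ, ?_⟩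
  have hspan : spanSingleton (𝓞 K)⁰ (b : K) = (P : FractionalIdeal (𝓞 K)⁰ K) ^ e := by
    rw [← coeIdeal_pow, ← hbP, coeIdeal_span_singleton]
  rw [hspan, hD, coeIdeal_pow, ← zpow_natCast, ← zpow_natCast, ← zpow_add₀ hP0, ← zpow_add₀ hP0]
  congr 1
  omega

end Levels

/-! ### The quadratic extension `L / ℚ(ζ + ζ⁻¹)` -/

section RealCyclotomic

variable {L : Type*} [Field L] [NumberField L] {ζ : L}

theorem pow_add_inv_pow_mem_realCyclotomicSubfield (hζ : ζ ≠ 0) :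
    ∀ k : ℕ, ζ ^ k + (ζ ^ k)⁻¹ ∈ realCyclotomicSubfield L ζ
  | 0 => by simpa using add_mem (one_mem _) (one_mem _)
  | 1 => by simpa using IntermediateField.mem_adjoin_simple_self ℚ (ζ + ζ⁻¹)
  | k + 2 => by
    have h0 := pow_add_inv_pow_mem_realCyclotomicSubfield hζ k
    have h1 := pow_add_inv_pow_mem_realCyclotomicSubfield hζ (k + 1)
    have h := sub_mem (mul_mem h1 (IntermediateField.mem_adjoin_simple_self ℚ (ζ + ζ⁻¹))) h0
    convert h using 1
    field_simp
    ring

variable {n : ℕ} [NeZero n]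

/-- A real number of modulus one is its own inverse, which would force `ζ² = 1`. -/
theorem notMem_realCyclotomicSubfield (hn : 2 < n) (hζ : IsPrimitiveRoot ζ n) :
    ζ ∉ realCyclotomicSubfield L ζ := by
  intro hmem
  have := isTotallyReal_realCyclotomicSubfield (NeZero.ne n) hζ
  have hle := (isTotallyReal_iff_le_maximalRealSubfield
    (E := (realCyclotomicSubfield L ζ).toSubfield)).mp this
  obtain ⟨φ⟩ : Nonempty (L →+* ℂ) := inferInstance
  have h1 : star (φ ζ) = φ ζ := hle hmem φ
  have h2 : ‖φ ζ‖ = 1 :=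
    Complex.norm_eq_one_of_pow_eq_one (by rw [← map_pow, hζ.pow_eq_one, map_one]) (NeZero.ne n)
  have h3 : (φ ζ)⁻¹ = φ ζ := (Complex.inv_eq_conj h2).trans h1
  have h4 : ζ ^ 2 = 1 := by
    apply φ.injective
    rw [map_pow, map_one, sq]
    nth_rewrite 1 [← h3]
    exact inv_mul_cancel₀ ((map_ne_zero φ).mpr (hζ.ne_zero (NeZero.ne n)))
  exact absurd (Nat.le_of_dvd two_pos (hζ.dvd_of_pow_eq_one 2 h4)) (by omega)

/-- The trace of `ζ` over the real subfield, as an algebraic integer. -/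
theorem exists_integer_eq_add_inv (hζ : IsPrimitiveRoot ζ n) :
    ∃ t : 𝓞 (realCyclotomicSubfield L ζ),
      algebraMap (𝓞 (realCyclotomicSubfield L ζ)) L t = ζ + ζ⁻¹ := by
  have h1 : IsIntegral ℤ (ζ + ζ⁻¹) :=
    (hζ.isIntegral (NeZero.pos n)).add (hζ.inv.isIntegral (NeZero.pos n))
  let x : realCyclotomicSubfield L ζ := ⟨ζ + ζ⁻¹, IntermediateField.mem_adjoin_simple_self ℚ _⟩
  have hx : IsIntegral ℤ x :=
    (isIntegral_algHom_iff (IsScalarTower.toAlgHom ℤ (realCyclotomicSubfield L ζ) L)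
      (algebraMap (realCyclotomicSubfield L ζ) L).injective).mp h1
  exact ⟨⟨x, hx⟩, rfl⟩

open Polynomial

theorem minpoly_toInteger (hn : 2 < n) (hζ : IsPrimitiveRoot ζ n)
    {t : 𝓞 (realCyclotomicSubfield L ζ)}
    (ht : algebraMap (𝓞 (realCyclotomicSubfield L ζ)) L t = ζ + ζ⁻¹) :
    minpoly (𝓞 (realCyclotomicSubfield L ζ)) hζ.toInteger = X ^ 2 - C t * X + 1 := by
  have hζ0 := hζ.ne_zero (NeZero.ne n)
  have hmon : (X ^ 2 - C t * X + 1 : (𝓞 (realCyclotomicSubfield L ζ))[X]).Monic := by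
    monicity!
  symm
  refine minpoly.unique' _ _ hmon ?_ fun q hq ↦ ?_
  · apply RingOfIntegers.coe_injective
    have h : algebraMap (𝓞 L) L
        (aeval hζ.toInteger (X ^ 2 - C t * X + 1 : (𝓞 (realCyclotomicSubfield L ζ))[X])) =
        ζ ^ 2 - algebraMap (𝓞 (realCyclotomicSubfield L ζ)) L t * ζ + 1 := by
      simp only [map_add, map_sub, map_mul, map_pow, map_one, aeval_X, aeval_C]
      rfl
    rw [h, ht, map_zero]
    field_simp
    ring
  -- A nonzero annihilator of degree at most one would put `ζ` in the real subfield.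
  · by_contra! hq0
    have hdeg : q.degree ≤ 1 := by
      have h2 : (X ^ 2 - C t * X + 1 : (𝓞 (realCyclotomicSubfield L ζ))[X]).degree = 2 := by
        compute_degree!
      rw [h2] at hq
      exact Order.le_of_lt_succ hq
    obtain ⟨a, b, rfl⟩ := exists_eq_X_add_C_of_natDegree_le_one (natDegree_le_of_degree_le hdeg)
    obtain ⟨hq0, hab⟩ := hq0
    have hab' :
        ((a : realCyclotomicSubfield L ζ) : L) * ζ + (b : realCyclotomicSubfield L ζ) = 0 := by
      have h := congrArg (algebraMap (𝓞 L) L) hab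
      simp only [map_add, map_mul, aeval_X, aeval_C, map_zero] at h
      exact h
    by_cases ha : a = 0
    · subst ha
      have hb : b = 0 := by simpa using hab'
      exact hq0 (by simp [hb])
    · have ha' : ((a : realCyclotomicSubfield L ζ) : L) ≠ 0 := by simpa using ha
      have hdiv := eq_div_of_mul_eq ha' ((mul_comm _ _).trans (eq_neg_of_add_eq_zero_left hab'))
      have hmem : -((b : realCyclotomicSubfield L ζ) : L) / (a : realCyclotomicSubfield L ζ) ∈
          realCyclotomicSubfield L ζ := div_mem (neg_mem (SetLike.coe_mem _)) (SetLike.coe_mem _)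
      exact notMem_realCyclotomicSubfield hn hζ (Set.mem_of_eq_of_mem hdiv hmem)

variable [IsCyclotomicExtension {n} ℚ L]

theorem adjoin_realCyclotomicSubfield_eq_top (hζ : IsPrimitiveRoot ζ n) :
    Algebra.adjoin (realCyclotomicSubfield L ζ) {ζ} = ⊤ := by
  have h := IsCyclotomicExtension.adjoin_primitive_root_eq_top (A := ℚ) hζ
  refine eq_top_iff.mpr fun x _ ↦ ?_
  have hx : x ∈ Algebra.adjoin ℚ {ζ} := h ▸ Algebra.mem_top
  have hle : Algebra.adjoin ℚ {ζ} ≤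
      (Algebra.adjoin (realCyclotomicSubfield L ζ) {ζ}).restrictScalars ℚ :=
    Algebra.adjoin_le Algebra.subset_adjoin
  exact hle hx

theorem finrank_realCyclotomicSubfield_top (hn : 2 < n) (hζ : IsPrimitiveRoot ζ n) :
    Module.finrank (realCyclotomicSubfield L ζ) L = 2 := by
  obtain ⟨t, ht⟩ := exists_integer_eq_add_inv hζ
  have h1 : IntermediateField.adjoin (realCyclotomicSubfield L ζ) {ζ} = ⊤ := by
    refine eq_top_iff.mpr fun x _ ↦ ?_
    have hx : x ∈ Algebra.adjoin (realCyclotomicSubfield L ζ) {ζ} :=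
      adjoin_realCyclotomicSubfield_eq_top hζ ▸ Algebra.mem_top
    exact IntermediateField.algebra_adjoin_le_adjoin _ _ hx
  rw [← (Field.primitive_element_iff_minpoly_natDegree_eq _ _).mp h1]
  have h2 := minpoly.isIntegrallyClosed_eq_field_fractions (realCyclotomicSubfield L ζ) L
    (Algebra.IsIntegral.isIntegral (R := 𝓞 (realCyclotomicSubfield L ζ)) hζ.toInteger)
  rw [minpoly_toInteger hn hζ ht] at h2
  rw [show minpoly (realCyclotomicSubfield L ζ) ζ = _ from h2,
    natDegree_map_eq_of_injective (FaithfulSMul.algebraMap_injective _ _)]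
  compute_degree!

/-- For `f = X² - tX + 1`, the relation `f(ζ) = 0` gives `ζ f'(ζ) = 2ζ² - tζ = ζ² - 1`. -/
theorem sq_sub_one_mem_differentIdeal (hn : 2 < n) (hζ : IsPrimitiveRoot ζ n) :
    hζ.toInteger ^ 2 - 1 ∈ differentIdeal (𝓞 (realCyclotomicSubfield L ζ)) (𝓞 L) := by
  obtain ⟨t, ht⟩ := exists_integer_eq_add_inv hζ
  have h := aeval_derivative_mem_differentIdeal (𝓞 (realCyclotomicSubfield L ζ))
    (realCyclotomicSubfield L ζ) L hζ.toInteger (adjoin_realCyclotomicSubfield_eq_top hζ)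
  have h0 := minpoly.aeval (𝓞 (realCyclotomicSubfield L ζ)) hζ.toInteger
  rw [minpoly_toInteger hn hζ ht] at h h0
  convert Ideal.mul_mem_left _ hζ.toInteger h using 1
  simp only [map_add, map_sub, map_mul, map_pow, map_one, aeval_X, aeval_C] at h0
  simp only [map_add, map_sub, map_mul, map_pow, aeval_X, aeval_C, derivative_X_pow,
    derivative_C_mul, derivative_X, derivative_one, Nat.cast_ofNat, mul_one, add_zero, map_ofNat]
  linear_combination -h0

end RealCyclotomic

/-! ### The discriminant exponent modulo `4` -/

theorem different_exponent_mod_four_of_one {p : ℕ} (hp : p % 4 = 1) (hp1 : 1 < p) (k : ℕ) :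
    p ^ k * ((p - 1) * (k + 1) - 1) % 4 = 3 := by
  have h1 : p ^ k % 4 = 1 := by simp [Nat.pow_mod, hp]
  have h2 : 0 < (p - 1) * (k + 1) := Nat.mul_pos (by omega) k.succ_pos
  have h3 : (p - 1) * (k + 1) % 4 = 0 := by
    rw [Nat.mul_mod, show (p - 1) % 4 = 0 by omega, zero_mul, Nat.zero_mod]
  rw [Nat.mul_mod, h1, show ((p - 1) * (k + 1) - 1) % 4 = 3 by omega]

/-- Both factors are `(-1) ^ k` modulo `4`. -/
theorem different_exponent_mod_four_of_three {p : ℕ} (hp : p % 4 = 3) (k : ℕ) :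
    p ^ k * ((p - 1) * (k + 1) - 1) % 4 = 1 := by
  have h2 : 0 < (p - 1) * (k + 1) := Nat.mul_pos (by omega) k.succ_pos
  have h3 : (p - 1) * (k + 1) % 4 = 2 * ((k + 1) % 4) % 4 := by
    rw [Nat.mul_mod, show (p - 1) % 4 = 2 by omega]
  rcases Nat.even_or_odd' k with ⟨j, rfl | rfl⟩
  · have h1 : p ^ (2 * j) % 4 = 1 := by
      rw [pow_mul, Nat.pow_mod, Nat.pow_mod p, hp]
      simp
    rw [Nat.mul_mod, h1, show ((p - 1) * (2 * j + 1) - 1) % 4 = 1 by omega]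
  · have h1 : p ^ (2 * j + 1) % 4 = 3 := by
      rw [pow_succ, pow_mul, Nat.mul_mod, Nat.pow_mod, Nat.pow_mod p, hp]
      simp
    rw [Nat.mul_mod, h1, show ((p - 1) * (2 * j + 1 + 1) - 1) % 4 = 3 by omega]

/-! ### Prime-power conductor -/

section PrimePow

variable {p k : ℕ} [hp : Fact p.Prime] {L : Type*} [Field L] [NumberField L]
  [IsCyclotomicExtension {p ^ (k + 1)} ℚ L] {ζ : L}

/-- The relative different has norm dividing `p`, and norm `1` is excluded because the exponent of
`discr L` is odd. -/
theorem exists_natAbs_discr_eq (hζ : IsPrimitiveRoot ζ (p ^ (k + 1))) (hp2 : p ≠ 2) :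
    ∃ d : ℕ, (discr (realCyclotomicSubfield L ζ)).natAbs = p ^ d ∧
      p ^ k * ((p - 1) * (k + 1) - 1) = 2 * d + 1 := by
  have hodd : Odd p := hp.out.odd_of_ne_two hp2
  have hp3 : 2 < p := lt_of_le_of_ne hp.out.two_le hp2.symm
  have hn : 2 < p ^ (k + 1) := hp3.trans_le (Nat.le_self_pow k.succ_ne_zero p)
  set e := p ^ k * ((p - 1) * (k + 1) - 1) with he
  have he_odd : Odd e := by
    refine hodd.pow.mul ?_
    have h1 : Even ((p - 1) * (k + 1)) := (hp.out.even_sub_one hp2).mul_right _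
    refine Nat.Even.sub_odd ?_ h1 odd_one
    exact Nat.mul_pos (by omega) k.succ_pos
  have hL : (discr L).natAbs = p ^ e := by
    rw [IsCyclotomicExtension.Rat.discr_prime_pow_succ p k L]
    simp [Int.natAbs_mul, Int.natAbs_pow, he]
  have htower := natAbs_discr_eq_absNorm_differentIdeal_mul_natAbs_discr_pow
    (realCyclotomicSubfield L ζ) (𝓞 (realCyclotomicSubfield L ζ)) L (𝓞 L)
  rw [hL, finrank_realCyclotomicSubfield_top hn hζ] at htower
  have hrel : Ideal.absNorm (differentIdeal (𝓞 (realCyclotomicSubfield L ζ)) (𝓞 L)) ∣ p := by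
    -- As `p` is odd, `ζ²` is again primitive, so `ζ² - 1` generates an ideal of norm `p`.
    have h2 : IsPrimitiveRoot (ζ ^ 2) (p ^ (k + 1)) :=
      hζ.pow_of_coprime 2 (Nat.Coprime.pow_right _ (Nat.coprime_two_left.mpr hodd))
    have h3 := IsCyclotomicExtension.Rat.absNorm_span_zeta_sub_one p k h2
    have h4 : h2.toInteger = hζ.toInteger ^ 2 := RingOfIntegers.ext rfl
    rw [h4] at h3
    exact h3 ▸ Ideal.absNorm_dvd_absNorm_of_le
      ((Ideal.span_singleton_le_iff_mem _).mpr (sq_sub_one_mem_differentIdeal hn hζ))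
  obtain ⟨d, -, hd⟩ := (Nat.dvd_prime_pow hp.out).mp
    ((dvd_pow_self _ two_ne_zero).trans (Dvd.intro_left _ htower.symm))
  refine ⟨d, hd, ?_⟩
  rw [hd, ← pow_mul] at htower
  rcases (Nat.dvd_prime hp.out).mp hrel with h | h
  · rw [h, one_mul] at htower
    have := Nat.pow_right_injective hp.out.two_le htower
    exact absurd he_odd (by rw [this, Nat.not_odd_iff_even]; exact even_two.mul_left _)
  · rw [h, ← pow_succ'] at htower
    have := Nat.pow_right_injective hp.out.two_le htower
    omega

theorem finrank_realCyclotomicSubfield (hζ : IsPrimitiveRoot ζ (p ^ (k + 1))) (hp2 : p ≠ 2) :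
    2 * Module.finrank ℚ (realCyclotomicSubfield L ζ) = p ^ k * (p - 1) := by
  have hp3 : 2 < p := lt_of_le_of_ne hp.out.two_le hp2.symm
  have hn : 2 < p ^ (k + 1) := hp3.trans_le (Nat.le_self_pow k.succ_ne_zero p)
  rw [← Nat.totient_prime_pow_succ hp.out, ← IsCyclotomicExtension.Rat.finrank (p ^ (k + 1)) L,
    ← Module.finrank_mul_finrank ℚ (realCyclotomicSubfield L ζ) L,
    finrank_realCyclotomicSubfield_top hn hζ, mul_comm]

/-- A subfield of the `p ^ (k + 1)`-th cyclotomic field has exactly one prime above `p`, and this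
prime has norm `p`. -/
theorem exists_ideal_absNorm_eq_prime (hζ : IsPrimitiveRoot ζ (p ^ (k + 1)))
    (F : IntermediateField ℚ L) :
    ∃ P : Ideal (𝓞 F), Ideal.absNorm P = p ∧
      ∀ Q : Ideal (𝓞 F), Q.IsPrime → Q.LiesOver (Ideal.span {(p : ℤ)}) → Q = P := by
  have hp0 : Ideal.span {(p : ℤ)} ≠ ⊥ := by simpa using hp.out.ne_zero
  have hprime := IsCyclotomicExtension.Rat.isPrime_span_zeta_sub_one p k hζ
  have hlies := IsCyclotomicExtension.Rat.liesOver_span_zeta_sub_one p k hζ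
  refine ⟨(Ideal.span {hζ.toInteger - 1}).under (𝓞 F), ?_, fun Q hQ hQp ↦ ?_⟩
  · have h1 := IsCyclotomicExtension.Rat.absNorm_span_zeta_sub_one p k hζ
    have : ((Ideal.span {hζ.toInteger - 1}).under (𝓞 F)).LiesOver (Ideal.span {(p : ℤ)}) :=
      Ideal.under_liesOver_of_liesOver _ _ _
    rw [Ideal.absNorm_eq_pow_inertiaDeg'_of_liesOver _
      ((Ideal.span {hζ.toInteger - 1}).under (𝓞 F)) inferInstance
      (Ideal.ne_bot_of_liesOver_of_ne_bot hp0 _)] at h1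
    have h2 := (Nat.Prime.eq_one_of_pow (h1.symm ▸ hp.out))
    rwa [h2, pow_one] at h1
  · have : Q.IsMaximal := hQ.isMaximal (Ideal.ne_bot_of_liesOver_of_ne_bot hp0 Q)
    obtain ⟨R, hR, hRQ⟩ := Ideal.exists_maximal_ideal_liesOver_of_isIntegral (S := 𝓞 L) Q
    have : R.LiesOver (Ideal.span {(p : ℤ)}) := Ideal.LiesOver.trans R Q _
    rw [hRQ.over, IsCyclotomicExtension.Rat.eq_span_zeta_sub_one_of_liesOver p k L hζ R]

omit [IsCyclotomicExtension {p ^ (k + 1)} ℚ L] in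
/-- The quadratic Gauss sum is a square root of `p` in the real subfield. -/
theorem exists_natCast_eq_mul_self (hζ : IsPrimitiveRoot ζ (p ^ (k + 1)))
    (hp4 : p % 4 = 1) :
    ∃ β : realCyclotomicSubfield L ζ, (p : realCyclotomicSubfield L ζ) = β * β := by
  have hp2 : p ≠ 2 := by omega
  have hξ : IsPrimitiveRoot (ζ ^ p ^ k) p := hζ.pow (pow_pos hp.out.pos _) (pow_succ p k)
  have hchar : ringChar (ZMod p) ≠ 2 := by rwa [ZMod.ringChar_zmod_n]
  let χ : MulChar (ZMod p) L := (quadraticChar (ZMod p)).ringHomComp (Int.castRingHom L)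
  let ψ : AddChar (ZMod p) L := AddChar.zmodChar p hξ.pow_eq_one
  have hχneg : χ (-1) = 1 := by
    have : quadraticChar (ZMod p) (-1) = 1 := by
      rw [quadraticChar_neg_one hchar, ZMod.card, ZMod.χ₄_nat_one_mod_four hp4]
    simp [χ, this]
  have hsq : gaussSum χ ψ ^ 2 = p := by
    rw [gaussSum_sq ((MulChar.ringHomComp_ne_one_iff Int.cast_injective).mpr
      (quadraticChar_ne_one hchar)) ((quadraticChar_isQuadratic (ZMod p)).comp _)
      (AddChar.zmodChar_primitive_of_primitive_root p hξ), hχneg, one_mul, ZMod.card]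
  have hζ0 : ζ ≠ 0 := hζ.ne_zero (pow_ne_zero _ hp.out.ne_zero)
  -- Since `χ` is even, averaging over `a ↦ -a` pairs each root of unity with its inverse.
  have h2 : 2 * gaussSum χ ψ ∈ realCyclotomicSubfield L ζ := by
    have h3 : gaussSum χ ψ = ∑ a, χ a * ψ (-a) := by
      rw [gaussSum, ← Equiv.sum_comp (Equiv.neg (ZMod p))]
      refine Finset.sum_congr rfl fun a _ ↦ ?_
      rw [Equiv.neg_apply, neg_eq_neg_one_mul a, map_mul χ, hχneg, one_mul]
    rw [two_mul]
    nth_rewrite 2 [h3]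
    rw [gaussSum, ← Finset.sum_add_distrib]
    refine sum_mem fun a _ ↦ ?_
    rw [← mul_add, AddChar.map_neg_eq_inv, AddChar.zmodChar_apply, ← pow_mul]
    refine mul_mem ?_ (pow_add_inv_pow_mem_realCyclotomicSubfield hζ0 _)
    exact intCast_mem _ (quadraticChar (ZMod p) a)
  have h4 : gaussSum χ ψ ∈ realCyclotomicSubfield L ζ := by
    have := mul_mem (inv_mem (ofNat_mem (realCyclotomicSubfield L ζ) 2)) h2
    rwa [inv_mul_cancel_left₀ two_ne_zero] at this
  refine ⟨⟨_, h4⟩, Subtype.ext ?_⟩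
  exact hsq.symm.trans (sq _)

end PrimePow

theorem mainTheorem4 (p r : ℕ) (hp : p.Prime) (hp_odd : Odd p) (hr : 0 < r)
    (L : Type*) [Field L] [NumberField L] [IsCyclotomicExtension {p ^ r} ℚ L]
    (ζ : L) (hζ : IsPrimitiveRoot ζ (p ^ r)) :
    haveI : IsTotallyReal (realCyclotomicSubfield L ζ) :=
      isTotallyReal_realCyclotomicSubfield (pow_ne_zero r hp.ne_zero) hζ
    (p % 4 = 3 → traceTypeLevels (realCyclotomicSubfield L ζ) = {1}) ∧
    (p % 8 = 1 → traceTypeLevels (realCyclotomicSubfield L ζ) = ∅) ∧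
    (p % 8 = 5 → traceTypeLevels (realCyclotomicSubfield L ζ) = {p}) := by
  obtain ⟨k, rfl⟩ : ∃ k, r = k + 1 := ⟨r - 1, by omega⟩
  have : Fact p.Prime := ⟨hp⟩
  have hp2 : p ≠ 2 := by
    rintro rfl
    exact absurd hp_odd (by decide)
  have := isTotallyReal_realCyclotomicSubfield (pow_ne_zero (k + 1) hp.ne_zero) hζ
  obtain ⟨d, hd, hd'⟩ := exists_natAbs_discr_eq hζ hp2
  have hn := finrank_realCyclotomicSubfield hζ hp2
  obtain ⟨P, hP, huniq⟩ := exists_ideal_absNorm_eq_prime hζ (realCyclotomicSubfield L ζ)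
  have hcop (m : ℕ) : Nat.Coprime (2 ^ m) (p ^ k) :=
    Nat.Coprime.pow _ _ (Nat.coprime_two_left.mpr hp_odd)
  have h4 : 4 ∣ p ^ k * (p - 1) ↔ p % 4 = 1 := by
    rw [show 4 = 2 ^ 2 from rfl, (hcop 2).dvd_mul_left]
    have := hp.one_lt
    omega
  have h8 : 8 ∣ p ^ k * (p - 1) ↔ p % 8 = 1 := by
    rw [show 8 = 2 ^ 3 from rfl, (hcop 3).dvd_mul_left]
    have := hp.one_lt
    omega
  have hodd : p % 4 = 1 → ¬ Even d := fun h ↦ by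
    have := different_exponent_mod_four_of_one h hp.one_lt k
    rw [hd'] at this
    rw [Nat.even_iff]
    omega
  have heven : p % 4 = 3 → Even d := fun h ↦ by
    have := different_exponent_mod_four_of_three h k
    rw [hd'] at this
    rw [Nat.even_iff]
    omega
  refine ⟨fun h ↦ ?_, fun h ↦ ?_, fun h ↦ ?_⟩
  · have h2 := heven h
    refine Set.eq_singleton_iff_unique_mem.mpr
      ⟨one_mem_traceTypeLevels hd hP huniq h2, fun ℓ hℓ ↦ ?_⟩
    rcases eq_of_mem_traceTypeLevels hd hℓ with h3 | h3
    · exact h3.1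
    -- By `h4`, `n` is odd, which rules out `4 ∣ n - 2d`.
    · omega
  · have h2 := hodd (by omega)
    refine Set.eq_empty_iff_forall_notMem.mpr fun ℓ hℓ ↦ ?_
    rcases eq_of_mem_traceTypeLevels hd hℓ with h3 | h3
    · exact h2 h3.2
    -- By `h8`, `4 ∣ n`, whereas `2d ≡ 2 mod 4`.
    · rw [Nat.not_even_iff] at h2
      omega
  · have h2 := hodd (by omega)
    obtain ⟨β, hβ⟩ := exists_natCast_eq_mul_self hζ (by omega)
    refine Set.eq_singleton_iff_unique_mem.mpr
      ⟨prime_mem_traceTypeLevels hd hP huniq hβ ?_, fun ℓ hℓ ↦ ?_⟩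
    -- By `h4` and `h8`, `n ≡ 2 ≡ 2d mod 4`.
    · rw [Nat.not_even_iff] at h2
      omega
    · rcases eq_of_mem_traceTypeLevels hd hℓ with h3 | h3
      · exact absurd h3.2 h2
      · exact h3.1
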